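/- Let $k$ be a field and let $\mathcal C$ be a $k$-linear abelian rigid tensor category: a $k$-linear abelian category in which every object has finite length and all Hom-spaces are finite-dimensional over $k$, equipped with a monoidal structure whose tensor product is $k$-bilinear on morphisms, such that every object has a left and a right dual and $\operatorname{End}(\mathbf 1)=k$ for the unit object $\mathbf 1$. Let $Gr(\mathcal C)$ be its Grothendieck ring: the free abelian group on the objects of $\mathcal C$ modulo the relations $[X_2]=[X_1]+[X_3]$ for all short exact sequences $0\to X_1\to X_2\to X_3\to 0$, with product $[X][Y]=[X\otimes Y]$ and identity $[\mathbf 1]$. Suppose that $\mathcal C$ has the Chevalley property, i.e. the tensor product of any two semisimple objects (finite direct sums of simple objects) of $\mathcal C$ is semisimple. Then $\mathcal C$ is virtually indecomposable: the only central idempotents of $Gr(\mathcal C)$ are $0$ and $1$. -/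

import Mathlib

open CategoryTheory CategoryTheory.Limits CategoryTheory.MonoidalCategory
open scoped ZeroObject

universe w v u

namespace TensorCat

section Objects

variable {C : Type u} [Category.{v} C] [Abelian C]

attribute [local instance] Abelian.hasFiniteBiproducts

/-- Objects of finite length: those obtained from zero by finitely many extensions by simple
objects, i.e. the objects that have a (finite) composition series. -/
inductive FiniteLength : C → Prop
  | zero {X : C} (hX : IsZero X) : FiniteLength X
  | ext {S : ShortComplex C} (hS : S.ShortExact) (h₁ : FiniteLength S.X₁)
      (h₃ : Simple S.X₃) : FiniteLength S.X₂

/-- Semisimple objects: finite direct sums of simple objects. -/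
def SemisimpleObj (X : C) : Prop :=
  ∃ (n : ℕ) (S : Fin n → C), (∀ i, Simple (S i)) ∧ Nonempty (X ≅ ⨁ S)

end Objects

/-- A `k`-linear abelian category is locally finite if all objects have finite length and all
Hom-spaces are finite-dimensional over `k`. -/
structure LocallyFinite (k : Type w) [Field k] (C : Type u) [Category.{v} C] [Abelian C]
    [Linear k C] : Prop where
  finiteLength : ∀ X : C, FiniteLength X
  finiteDimensional_hom : ∀ X Y : C, FiniteDimensional k (X ⟶ Y)

/-- `End(𝟙) = k`: every endomorphism of the unit object is a unique scalar multiple of the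
identity. -/
def EndUnitEqScalars (k : Type w) [Field k] (C : Type u) [Category.{v} C] [Abelian C]
    [Linear k C] [MonoidalCategory C] : Prop :=
  Function.Bijective (fun a : k => (a • 𝟙 (𝟙_ C) : 𝟙_ C ⟶ 𝟙_ C))

/-- The Chevalley property: the tensor product of two semisimple objects is semisimple. -/
def ChevalleyProperty (C : Type u) [Category.{v} C] [Abelian C] [MonoidalCategory C] : Prop :=
  ∀ X Y : C, SemisimpleObj X → SemisimpleObj Y → SemisimpleObj (X ⊗ Y)

section GrothendieckGroup

variable (C : Type u) [Category.{v} C] [Abelian C]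

/-- The relations `[X₂] = [X₁] + [X₃]` for all short exact sequences
`0 ⟶ X₁ ⟶ X₂ ⟶ X₃ ⟶ 0`. -/
def exactRelations : AddSubgroup (FreeAbelianGroup C) :=
  AddSubgroup.closure { r | ∃ S : ShortComplex C, S.ShortExact ∧
    r = FreeAbelianGroup.of S.X₂ - (FreeAbelianGroup.of S.X₁ + FreeAbelianGroup.of S.X₃) }

/-- The Grothendieck group `Gr(C)` of an abelian category: the free abelian group on the objects
modulo the relations given by the short exact sequences. -/
def Gr : Type u := FreeAbelianGroup C ⧸ exactRelations C

namespace Gr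

noncomputable instance : AddCommGroup (Gr C) :=
  inferInstanceAs (AddCommGroup (FreeAbelianGroup C ⧸ exactRelations C))

variable {C}

/-- The class `[X]` of an object in the Grothendieck group. -/
def cls (X : C) : Gr C := QuotientAddGroup.mk' (exactRelations C) (FreeAbelianGroup.of X)

theorem cls_shortExact {S : ShortComplex C} (hS : S.ShortExact) :
    cls S.X₂ = cls S.X₁ + cls S.X₃ := by
  have h : FreeAbelianGroup.of S.X₂ - (FreeAbelianGroup.of S.X₁ + FreeAbelianGroup.of S.X₃) ∈
      exactRelations C := AddSubgroup.subset_closure ⟨S, hS, rfl⟩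
  have h' := (QuotientAddGroup.eq_zero_iff _).2 h
  exact sub_eq_zero.1 h'

/-- Additive functions on objects induce homomorphisms on the Grothendieck group. -/
def lift {A : Type*} [AddCommGroup A] (f : C → A)
    (hf : ∀ S : ShortComplex C, S.ShortExact → f S.X₂ = f S.X₁ + f S.X₃) : Gr C →+ A :=
  QuotientAddGroup.lift (exactRelations C) (FreeAbelianGroup.lift f) (by
    rw [exactRelations, AddSubgroup.closure_le]
    rintro _ ⟨S, hS, rfl⟩
    simp [AddMonoidHom.mem_ker, hf S hS])

@[simp]
theorem lift_cls {A : Type*} [AddCommGroup A] (f : C → A)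
    (hf : ∀ S : ShortComplex C, S.ShortExact → f S.X₂ = f S.X₁ + f S.X₃) (X : C) :
    lift f hf (cls X) = f X :=
  FreeAbelianGroup.lift_apply_of f X

theorem hom_ext {A : Type*} [AddCommGroup A] {f g : Gr C →+ A}
    (h : ∀ X, f (cls X) = g (cls X)) : f = g :=
  QuotientAddGroup.addMonoidHom_ext _ (FreeAbelianGroup.lift_ext _ _ h)

theorem induction_cls {p : Gr C → Prop} (x : Gr C) (cls : ∀ X, p (cls X))
    (add : ∀ x y, p x → p y → p (x + y)) (neg : ∀ x, p x → p (-x)) : p x := by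
  obtain ⟨y, rfl⟩ := QuotientAddGroup.mk'_surjective (exactRelations C) x
  induction y using FreeAbelianGroup.induction_on with
  | zero =>
    have h := add _ _ (cls 0) (neg _ (cls 0))
    rw [add_neg_cancel] at h
    exact h
  | of X => exact cls X
  | neg X h => exact neg _ h
  | add x y hx hy => exact add _ _ hx hy

theorem cls_iso {X Y : C} (e : X ≅ Y) : cls X = cls Y := by
  have hz : ∀ Z : C, IsZero Z → cls Z = 0 := fun Z hZ => by
    have h := cls_shortExact (S := ShortComplex.mk (0 : Z ⟶ Z) (𝟙 Z) (by simp))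
      { exact := ShortComplex.exact_of_isZero_X₂ _ hZ
        mono_f := ⟨fun _ _ _ => hZ.eq_of_tgt _ _⟩
        epi_g := (inferInstance : Epi (𝟙 Z)) }
    simpa using h
  have h := cls_shortExact (S := ShortComplex.mk e.hom (0 : Y ⟶ (0 : C)) (by simp))
    { exact := (ShortComplex.exact_iff_epi _ rfl).2 (inferInstance : Epi e.hom)
      mono_f := (inferInstance : Mono e.hom)
      epi_g := ⟨fun _ _ _ => (isZero_zero C).eq_of_src _ _⟩ }
  simpa [hz _ (isZero_zero C)] using h.symm

end Gr

end GrothendieckGroup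

section GrothendieckRing

variable {C : Type u} [Category.{v} C] [Abelian C] [MonoidalCategory C] [MonoidalPreadditive C]
  [RigidCategory C]

theorem shortExact_tensorLeft (X : C) {S : ShortComplex C} (hS : S.ShortExact) :
    (S.map (tensorLeft X)).ShortExact := by
  have := (tensorLeftAdjunction X (Xᘁ)).rightAdjoint_preservesLimits
  have := (tensorLeftAdjunction (ᘁX) X).leftAdjoint_preservesColimits
  exact hS.map_of_exact (tensorLeft X)

theorem shortExact_tensorRight (X : C) {S : ShortComplex C} (hS : S.ShortExact) :
    (S.map (tensorRight X)).ShortExact := by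
  have := (tensorRightAdjunction (ᘁX) X).rightAdjoint_preservesLimits
  have := (tensorRightAdjunction X (Xᘁ)).leftAdjoint_preservesColimits
  exact hS.map_of_exact (tensorRight X)

namespace Gr

theorem cls_tensorLeft (X : C) (S : ShortComplex C) (hS : S.ShortExact) :
    cls (X ⊗ S.X₂) = cls (X ⊗ S.X₁) + cls (X ⊗ S.X₃) :=
  cls_shortExact (shortExact_tensorLeft X hS)

theorem cls_tensorRight (X : C) (S : ShortComplex C) (hS : S.ShortExact) :
    cls (S.X₂ ⊗ X) = cls (S.X₁ ⊗ X) + cls (S.X₃ ⊗ X) :=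
  cls_shortExact (shortExact_tensorRight X hS)

/-- The biadditive multiplication of the Grothendieck ring, with `[X] * [Y] = [X ⊗ Y]`. -/
noncomputable def mulHom : Gr C →+ Gr C →+ Gr C :=
  lift (fun X => lift (fun Y => cls (X ⊗ Y)) (cls_tensorLeft X))
    (fun S hS => hom_ext fun Y => by
      rw [AddMonoidHom.add_apply, lift_cls, lift_cls, lift_cls]
      exact cls_tensorRight Y S hS)

theorem mulHom_cls (X Y : C) : mulHom (cls X) (cls Y) = cls (X ⊗ Y) := by
  rw [mulHom, lift_cls, lift_cls]

/-- The Grothendieck ring of a rigid tensor category: the product is induced by the tensor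
product, `[X] * [Y] = [X ⊗ Y]`, and the identity is the class of the unit object. -/
noncomputable instance : Ring (Gr C) :=
  { (inferInstance : AddCommGroup (Gr C)) with
    mul := fun x y => mulHom x y
    one := cls (𝟙_ C)
    left_distrib := fun x y z => map_add (mulHom x) y z
    right_distrib := fun x y z => by
      change mulHom (x + y) z = mulHom x z + mulHom y z
      rw [map_add, AddMonoidHom.add_apply]
    zero_mul := fun x => by
      change mulHom 0 x = 0
      rw [map_zero, AddMonoidHom.zero_apply]
    mul_zero := fun x => map_zero (mulHom x)
    one_mul := fun x => by
      have h : mulHom (cls (𝟙_ C)) = AddMonoidHom.id (Gr C) := hom_ext fun X => by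
        rw [mulHom_cls]
        exact cls_iso (λ_ X)
      exact DFunLike.congr_fun h x
    mul_one := fun x => by
      have h : mulHom.flip (cls (𝟙_ C)) = AddMonoidHom.id (Gr C) := hom_ext fun X => by
        rw [AddMonoidHom.flip_apply, mulHom_cls]
        exact cls_iso (ρ_ X)
      exact DFunLike.congr_fun h x
    mul_assoc := fun x y z => by
      change mulHom (mulHom x y) z = mulHom x (mulHom y z)
      induction x using induction_cls with
      | cls X =>
        induction y using induction_cls with
        | cls Y =>
          induction z using induction_cls with
          | cls Z =>
            simp only [mulHom_cls]
            exact cls_iso (α_ X Y Z)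
          | add z z' hz hz' => simp only [map_add, hz, hz']
          | neg z hz => simp only [map_neg, hz]
        | add y y' hy hy' => simp only [map_add, AddMonoidHom.add_apply, hy, hy']
        | neg y hy => simp only [map_neg, AddMonoidHom.neg_apply, hy]
      | add x x' hx hx' => simp only [map_add, AddMonoidHom.add_apply, hx, hx']
      | neg x hx => simp only [map_neg, AddMonoidHom.neg_apply, hx]
    zsmul := fun n x => n • x
    nsmul := fun n x => n • x }

theorem cls_mul_cls (X Y : C) : cls X * cls Y = cls (X ⊗ Y) := mulHom_cls X Y

theorem one_eq_cls : (1 : Gr C) = cls (𝟙_ C) := rfl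

end Gr

variable (C) in
/-- A tensor category is virtually indecomposable if its Grothendieck ring has no central
idempotents other than `0` and `1`. -/
def VirtuallyIndecomposable : Prop :=
  ∀ e : Gr C, e ∈ Subring.center (Gr C) → IsIdempotentElem e → e = 0 ∨ e = 1

end GrothendieckRing

end TensorCat

namespace TensorCat

/-! ### Jordan–Hölder for additive weights -/

section JordanHolder

variable {C : Type u} [Category.{v} C] [Abelian C]

/-! Let `τ` be the multiplicity of the unit object and `D` the anti-multiplicative map induced by
right duals, and consider the pairing `τ (x * D y)` on the Grothendieck ring. For simple `X`, `Y`,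
maps `𝟙 ⟶ X ⊗ Yᘁ` correspond to maps `Y ⟶ X`, so a nonzero one exists exactly when `X ≅ Y`. By the
Chevalley property `X ⊗ Yᘁ` is semisimple, so the absence of such maps forces multiplicity zero. The
classes of simples are therefore orthogonal with positive norms, and the pairing is positive
definite.

For a central idempotent `f`, the element `f - f * D f` has norm zero, so `f = f * D f` and `τ f ≥
0`. Applied to `e` and `1 - e`, whose `τ` values are integers with sum `τ 1 = 1`, this makes one of
the two values zero, and definiteness kills that element.

The main inputs are `Gr.exists_hom_of_weight` (existence of `τ`), `shortExact_dualComplex`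
(existence of `D`), `simple_unit`, `exists_unit_hom_ne_zero_iff`, and the purely algebraic
`eq_zero_or_one_of_central_idempotent`. -/

theorem shortExact_of_exists_lift {S : ShortComplex C} [Mono S.f] [Epi S.g]
    (h : ∀ {A : C} (k : A ⟶ S.X₂), k ≫ S.g = 0 → ∃ l : A ⟶ S.X₁, l ≫ S.f = k) :
    S.ShortExact where
  exact := S.exact_iff_exact_up_to_refinements.2 fun A k hk => by
    obtain ⟨l, hl⟩ := h k hk
    exact ⟨A, 𝟙 A, inferInstance, l, by rw [Category.id_comp, hl]⟩

theorem shortExact_exists_lift {S : ShortComplex C} (hS : S.ShortExact) {A : C} (k : A ⟶ S.X₂)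
    (hk : k ≫ S.g = 0) : ∃ l : A ⟶ S.X₁, l ≫ S.f = k := by
  have := hS.mono_f
  exact ⟨hS.exact.lift k hk, hS.exact.lift_f k hk⟩

theorem shortExact_exists_desc {S : ShortComplex C} (hS : S.ShortExact) {A : C} (k : S.X₂ ⟶ A)
    (hk : S.f ≫ k = 0) : ∃ l : S.X₃ ⟶ A, S.g ≫ l = k := by
  have := hS.epi_g
  exact ⟨hS.exact.desc k hk, hS.exact.g_desc k hk⟩

theorem shortExact_kernel {X Y : C} (g : X ⟶ Y) [Epi g] :
    (ShortComplex.mk (kernel.ι g) g (kernel.condition g)).ShortExact :=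
  shortExact_of_exists_lift fun k hk => ⟨kernel.lift g k hk, kernel.lift_ι g k hk⟩

theorem shortExact_cokernel {X Y : C} (f : X ⟶ Y) [Mono f] :
    (ShortComplex.mk f (cokernel.π f) (cokernel.condition f)).ShortExact where
  exact := ShortComplex.exact_cokernel f

theorem shortExact_of_iso_middle {S : ShortComplex C} (hS : S.ShortExact) {Y : C}
    (e : S.X₂ ≅ Y) : (ShortComplex.mk (S.f ≫ e.hom) (e.inv ≫ S.g) (by simp)).ShortExact :=
  ShortComplex.shortExact_of_iso (S₁ := S)
    (ShortComplex.isoMk (Iso.refl _) e (Iso.refl _) (by simp) (by simp)) hS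

variable {A : Type*} [AddCommGroup A]

/-- `HasValue w X a`: the object `X` has a composition series along which the weights `w` of the
simple factors add up to `a`. -/
inductive HasValue (w : C → A) : C → A → Prop
  | zero {X : C} (hX : IsZero X) : HasValue w X 0
  | ext {S : ShortComplex C} {a : A} (hS : S.ShortExact) (h₁ : HasValue w S.X₁ a)
      (h₃ : Simple S.X₃) : HasValue w S.X₂ (a + w S.X₃)

theorem HasValue.of_iso {w : C → A} {X Y : C} {a : A} (h : HasValue w X a) (e : X ≅ Y) :
    HasValue w Y a := by
  cases h with
  | zero hX => exact .zero (hX.of_iso e.symm)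
  | ext hS h₁ h₃ => exact .ext (shortExact_of_iso_middle hS e) h₁ h₃

theorem FiniteLength.exists_hasValue (w : C → A) {X : C} (h : FiniteLength X) :
    ∃ a, HasValue w X a := by
  induction h with
  | zero hX => exact ⟨0, .zero hX⟩
  | ext hS _ h₃ ih =>
    obtain ⟨a, ha⟩ := ih
    exact ⟨_, .ext hS ha h₃⟩

theorem HasValue.eq_zero {w : C → A} {X : C} {a : A} (h : HasValue w X a) (hX : IsZero X) :
    a = 0 := by
  cases h with
  | zero => rfl
  | @ext S _ hS _ h₃ =>
    have := hS.epi_g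
    exact (Simple.not_isZero _ (hX.of_epi S.g)).elim

/-- Any simple quotient may be taken as the top factor of a composition series. -/
theorem HasValue.exists_of_simple_quotient {w : C → A}
    (hw : ∀ S T : C, Simple S → (S ≅ T) → w S = w T) {X : C} {a : A} (h : HasValue w X a)
    {S : ShortComplex C} (hS : S.ShortExact) (h₃ : Simple S.X₃) (e : S.X₂ ≅ X) :
    ∃ b, HasValue w S.X₁ b ∧ a = b + w S.X₃ := by
  induction h generalizing S with
  | zero hX =>
    have := hS.epi_g
    exact (Simple.not_isZero _ ((hX.of_iso e).of_epi S.g)).elim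
  | @ext R a hR h₁ hR₃ ih =>
    obtain ⟨q, hq⟩ : ∃ q, q = e.inv ≫ S.g := ⟨_, rfl⟩
    have := hS.epi_g
    have := hS.mono_f
    have := hR.epi_g
    have := hR.mono_f
    have hqe : Epi q := hq ▸ inferInstance
    -- If the composite vanishes, both quotients have the same kernel. Otherwise the two maximal
    -- subobjects differ, and their intersection `kernel (R.f ≫ q)` links the two series.
    by_cases h0 : R.f ≫ q = 0
    · obtain ⟨t, ht⟩ := shortExact_exists_desc hR q h0
      have : Epi t := epi_of_epi_fac ht
      have ht0 : t ≠ 0 := by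
        rintro rfl
        exact Simple.not_isZero S.X₃ (by
          rw [IsZero.iff_id_eq_zero, ← cancel_epi q, ← ht]; simp)
      have := isIso_of_epi_of_nonzero ht0
      obtain ⟨i, hi⟩ := shortExact_exists_lift hS (R.f ≫ e.inv) (by
        rw [Category.assoc, ← hq, h0])
      obtain ⟨j, hj⟩ := shortExact_exists_lift hR (S.f ≫ e.hom) (by
        rw [← cancel_mono t, Category.assoc, ht, hq]; simp)
      have hij : i ≫ j = 𝟙 _ := by
        rw [← cancel_mono R.f, Category.assoc, hj, reassoc_of% hi]; simp
      have hji : j ≫ i = 𝟙 _ := by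
        rw [← cancel_mono S.f, Category.assoc, hi, reassoc_of% hj]; simp
      exact ⟨a, h₁.of_iso ⟨i, j, hij, hji⟩, by rw [hw _ _ hR₃ (asIso t)]⟩
    · have hep : Epi (R.f ≫ q) := epi_of_nonzero_to_simple h0
      obtain ⟨b, hb, rfl⟩ := ih (shortExact_kernel (R.f ≫ q)) h₃ (Iso.refl _)
      obtain ⟨i, hi⟩ := shortExact_exists_lift hS (kernel.ι (R.f ≫ q) ≫ R.f ≫ e.inv) (by
        have := kernel.condition (R.f ≫ q)
        simpa [hq] using this)
      have hz : i ≫ S.f ≫ e.hom ≫ R.g = 0 := by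
        rw [reassoc_of% hi]; simp
      have : Mono i := by
        have : Mono (i ≫ S.f) := hi ▸ inferInstance
        exact mono_of_mono i S.f
      have : Epi (S.f ≫ e.hom ≫ R.g) := by
        refine Preadditive.epi_of_cancel_zero _ fun {Z} g hg => ?_
        obtain ⟨t, ht⟩ := shortExact_exists_desc hS (e.hom ≫ R.g ≫ g) (by simpa using hg)
        have ht' : q ≫ t = R.g ≫ g := by rw [hq, Category.assoc, ht]; simp
        have : t = 0 := by
          rw [← cancel_epi (R.f ≫ q), Category.assoc, ht']; simp
        rw [← cancel_epi R.g, ← ht', this]; simp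
      -- Second isomorphism theorem: the quotient of `S.X₁` by the intersection is `R.X₃`.
      have hE : (ShortComplex.mk i (S.f ≫ e.hom ≫ R.g) hz).ShortExact := by
        refine shortExact_of_exists_lift fun {Z} k hk => ?_
        obtain ⟨l, hl⟩ := shortExact_exists_lift hR (k ≫ S.f ≫ e.hom) (by simpa using hk)
        refine ⟨kernel.lift _ l ?_, ?_⟩
        · rw [reassoc_of% hl, hq]; simp
        · dsimp
          rw [← cancel_mono S.f, Category.assoc, hi, kernel.lift_ι_assoc, reassoc_of% hl]; simp
      exact ⟨b + w R.X₃, .ext hE hb hR₃, by abel⟩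

theorem HasValue.unique {w : C → A} (hw : ∀ S T : C, Simple S → (S ≅ T) → w S = w T) {X : C}
    {a b : A} (ha : HasValue w X a) (hb : HasValue w X b) : a = b := by
  induction hb generalizing a with
  | zero hX => exact ha.eq_zero hX
  | ext hS _ h₃ ih =>
    obtain ⟨b, hb, rfl⟩ := ha.exists_of_simple_quotient hw hS h₃ (Iso.refl _)
    rw [ih hb]

/-- A series of the quotient is pulled back and stacked on one of the subobject. The isomorphism `e`
lets the induction run on a series of `Y` while `S` varies. -/
theorem HasValue.add {w : C → A} {S : ShortComplex C} (hS : S.ShortExact) {a b : A}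
    (ha : HasValue w S.X₁ a) {Y : C} (hb : HasValue w Y b) (e : Y ≅ S.X₃) :
    HasValue w S.X₂ (a + b) := by
  induction hb generalizing S with
  | zero hX =>
    have := hS.isIso_f_iff.2 (hX.of_iso e.symm)
    simpa using ha.of_iso (asIso S.f)
  | @ext R b hR h₁ hR₃ ih =>
    have := hS.epi_g
    have := hS.mono_f
    have := hR.epi_g
    have := hR.mono_f
    -- The kernel of `q` is the preimage of `R.X₁`, an extension of `R.X₁` by `S.X₁`, to which the
    -- induction hypothesis applies.
    obtain ⟨q, hq⟩ : ∃ q, q = S.g ≫ e.inv ≫ R.g := ⟨_, rfl⟩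
    have : Epi q := hq ▸ inferInstance
    obtain ⟨i, hi⟩ := shortExact_exists_lift (shortExact_kernel q) S.f (by simp [hq])
    obtain ⟨p, hp⟩ := shortExact_exists_lift hR (kernel.ι q ≫ S.g ≫ e.inv) (by
      have := kernel.condition q
      simpa [hq] using this)
    dsimp at i hi
    have : Mono (i ≫ kernel.ι q) := hi ▸ inferInstance
    have : Mono i := mono_of_mono i (kernel.ι q)
    have hz : i ≫ p = 0 := by
      rw [← cancel_mono R.f, Category.assoc, hp, reassoc_of% hi]; simp
    have : Epi p := by
      refine Preadditive.epi_of_cancel_zero _ fun {Z} g hg => ?_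
      rw [← cancel_epi (pullback.snd (S.g ≫ e.inv) R.f), comp_zero]
      have hc := pullback.condition (f := S.g ≫ e.inv) (g := R.f)
      have hl : pullback.fst (S.g ≫ e.inv) R.f ≫ q = 0 := by
        have := hc =≫ R.g
        simpa [hq] using this
      have : pullback.snd (S.g ≫ e.inv) R.f = kernel.lift q _ hl ≫ p := by
        rw [← cancel_mono R.f, Category.assoc, hp, kernel.lift_ι_assoc, hc]
      rw [this, Category.assoc, hg, comp_zero]
    have hE : (ShortComplex.mk i p hz).ShortExact := by
      refine shortExact_of_exists_lift fun {Z} k hk => ?_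
      obtain ⟨l, hl⟩ := shortExact_exists_lift hS (k ≫ kernel.ι q) (by
        have := hk =≫ R.f
        rw [← cancel_mono e.inv]
        simpa [hp] using this)
      refine ⟨l, ?_⟩
      dsimp
      rw [← cancel_mono (kernel.ι q), Category.assoc, hi, hl]
    rw [← add_assoc]
    exact .ext (shortExact_kernel q) (ih hE ha (Iso.refl _)) hR₃

/-- **Jordan–Hölder**: if all objects have finite length, an isomorphism-invariant weight on simple
objects extends to an additive function on the Grothendieck group. -/
theorem Gr.exists_hom_of_weight (hfin : ∀ X : C, FiniteLength X) (w : C → A)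
    (hw : ∀ S T : C, Simple S → (S ≅ T) → w S = w T) :
    ∃ φ : Gr C →+ A, ∀ S : C, Simple S → φ (cls S) = w S := by
  choose f hf using fun X => (hfin X).exists_hasValue w
  refine ⟨lift f fun S hS => (hf S.X₂).unique hw (.add hS (hf _) (hf _) (Iso.refl _)),
    fun S hS => ?_⟩
  rw [lift_cls]
  refine (hf S).unique hw ?_
  have := HasValue.ext (w := w) (shortExact_kernel (𝟙 S)) (.zero (isZero_kernel_of_mono _)) hS
  simpa using this

end JordanHolder

/-! ### Simple classes generate; classes of direct sums -/

section Generation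

variable {C : Type u} [Category.{v} C] [Abelian C]

theorem Gr.cls_eq_zero {X : C} (hX : IsZero X) : cls X = 0 := by
  have h := cls_shortExact (shortExact_cokernel (𝟙 X))
  have h' := cls_iso ((isZero_cokernel_of_epi (𝟙 X)).iso hX)
  dsimp at h
  rw [h'] at h
  simpa using h

/-- The Grothendieck group is spanned by the classes of simple objects, as soon as every simple
object is isomorphic to a member of the given family. -/
theorem Gr.span_simple_eq_top (hfin : ∀ X : C, FiniteLength X) {I : Type*} (T : I → C)
    (hT : ∀ X : C, Simple X → ∃ i, Nonempty (X ≅ T i)) :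
    Submodule.span ℤ (Set.range fun i => cls (T i)) = ⊤ := by
  rw [eq_top_iff]
  rintro x -
  induction x using Gr.induction_cls with
  | cls X =>
    induction hfin X with
    | zero hX =>
      rw [cls_eq_zero hX]
      exact zero_mem _
    | ext hS _ h₃ ih =>
      obtain ⟨i, ⟨e⟩⟩ := hT _ h₃
      rw [cls_shortExact hS, cls_iso e]
      exact add_mem ih (Submodule.subset_span ⟨i, rfl⟩)
  | add x y hx hy => exact add_mem hx hy
  | neg x hx => exact neg_mem hx

theorem Gr.nonneg_of_simple_nonneg (hfin : ∀ X : C, FiniteLength X) (φ : Gr C →+ ℤ)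
    (hφ : ∀ S : C, Simple S → 0 ≤ φ (cls S)) (X : C) : 0 ≤ φ (cls X) := by
  induction hfin X with
  | zero hX => rw [cls_eq_zero hX, map_zero]
  | ext hS _ h₃ ih =>
    rw [cls_shortExact hS, map_add]
    exact add_nonneg ih (hφ _ h₃)

attribute [local instance] Abelian.hasFiniteBiproducts

theorem shortExact_biproduct_fin_succ {n : ℕ} (f : Fin (n + 1) → C) :
    (ShortComplex.mk (biproduct.ι f 0)
      (biproduct.lift fun i : Fin n => biproduct.π f i.succ : ⨁ f ⟶ ⨁ fun i => f i.succ) (by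
        ext i
        simp [biproduct.ι_π_ne f (Fin.succ_ne_zero i).symm])).ShortExact := by
  have : Epi (biproduct.lift fun i : Fin n => biproduct.π f i.succ : ⨁ f ⟶ ⨁ fun i => f i.succ) := by
    have h : biproduct.desc (fun i : Fin n => biproduct.ι f i.succ) ≫
        (biproduct.lift fun i : Fin n => biproduct.π f i.succ : ⨁ f ⟶ ⨁ fun i => f i.succ) = 𝟙 _ := by
      ext i j
      by_cases hij : i = j
      · subst hij; simp
      · simp [biproduct.ι_π_ne _ (Ne.symm hij),
          biproduct.ι_π_ne f (fun h => hij (Fin.succ_injective n h).symm : j.succ ≠ i.succ)]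
    exact epi_of_epi_fac h
  refine shortExact_of_exists_lift fun {A} k hk => ⟨k ≫ biproduct.π f 0, ?_⟩
  dsimp at k hk ⊢
  refine biproduct.hom_ext _ _ fun j => ?_
  cases j using Fin.cases with
  | zero => simp
  | succ j =>
    have := hk =≫ biproduct.π _ j
    simp only [Category.assoc, biproduct.lift_π, zero_comp] at this
    simp [this, biproduct.ι_π_ne f (Fin.succ_ne_zero j).symm]

theorem Gr.cls_biproduct {n : ℕ} (f : Fin n → C) : cls (⨁ f) = ∑ i, cls (f i) := by
  induction n with
  | zero =>
    rw [Finset.univ_eq_empty, Finset.sum_empty]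
    refine cls_eq_zero ((IsZero.iff_id_eq_zero _).2 ?_)
    ext i
    exact i.elim0
  | succ n ih =>
    rw [cls_shortExact (shortExact_biproduct_fin_succ f), Fin.sum_univ_succ, ih]

theorem SemisimpleObj.of_simple {X : C} (hX : Simple X) : SemisimpleObj X := by
  refine ⟨1, fun _ => X, fun _ => hX, ⟨⟨biproduct.lift fun _ => 𝟙 X, biproduct.π _ 0, ?_, ?_⟩⟩⟩
  · simp
  · refine biproduct.hom_ext _ _ fun j => ?_
    simp [Subsingleton.elim j 0]

theorem FiniteLength.exists_simple_mono {X : C} (h : FiniteLength X) (hX : ¬ IsZero X) :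
    ∃ (S : C) (f : S ⟶ X), Simple S ∧ Mono f := by
  induction h with
  | zero h => exact (hX h).elim
  | @ext S hS _ h₃ ih =>
    have := hS.mono_f
    by_cases h₁ : IsZero S.X₁
    · have := hS.isIso_g_iff.2 h₁
      exact ⟨S.X₃, inv S.g, h₃, inferInstance⟩
    · obtain ⟨T, f, hT, hf⟩ := ih h₁
      exact ⟨T, f ≫ S.f, hT, mono_comp _ _⟩

end Generation

/-! ### Multiplicity of a simple object -/

section Multiplicity

variable {C : Type u} [Category.{v} C] [Abelian C]

open Classical in
/-- The multiplicity of a fixed simple object as a function on the Grothendieck group. -/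
theorem Gr.exists_multiplicity (hfin : ∀ X : C, FiniteLength X) (T : C) :
    ∃ φ : Gr C →+ ℤ, ∀ S : C, Simple S → φ (cls S) = if Nonempty (S ≅ T) then 1 else 0 :=
  exists_hom_of_weight hfin _ fun S S' _ e => by
    congr 1
    exact propext ⟨fun ⟨f⟩ => ⟨e.symm ≪≫ f⟩, fun ⟨f⟩ => ⟨e ≪≫ f⟩⟩

open Classical in
theorem Gr.multiplicity_pos (hfin : ∀ X : C, FiniteLength X) {T : C} (hT : Simple T)
    {φ : Gr C →+ ℤ} (hφ : ∀ S : C, Simple S → φ (cls S) = if Nonempty (S ≅ T) then 1 else 0)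
    {X : C} {f : T ⟶ X} (hf : f ≠ 0) : 0 < φ (cls X) := by
  have := mono_of_nonzero_from_simple hf
  rw [cls_shortExact (shortExact_cokernel f), map_add, hφ T hT, if_pos ⟨Iso.refl _⟩]
  have := nonneg_of_simple_nonneg hfin φ (fun S hS => by rw [hφ S hS]; split <;> simp) (cokernel f)
  dsimp at this ⊢
  lia

attribute [local instance] Abelian.hasFiniteBiproducts

open Classical in
-- Semisimplicity is essential: only then is each composition factor a direct summand, hence the
-- image of a map from `T`.
theorem Gr.multiplicity_eq_zero {T : C} {φ : Gr C →+ ℤ}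
    (hφ : ∀ S : C, Simple S → φ (cls S) = if Nonempty (S ≅ T) then 1 else 0)
    {X : C} (hX : SemisimpleObj X) (h : ∀ f : T ⟶ X, f = 0) : φ (cls X) = 0 := by
  obtain ⟨n, S, hS, ⟨e⟩⟩ := hX
  rw [cls_iso e, cls_biproduct, map_sum]
  refine Finset.sum_eq_zero fun i _ => ?_
  rw [hφ _ (hS i), if_neg]
  rintro ⟨g⟩
  have h0 := h (g.inv ≫ biproduct.ι S i ≫ e.inv)
  have := hS i
  refine id_nonzero (S i) ?_
  have h1 := g.hom ≫= h0 =≫ (e.hom ≫ biproduct.π S i)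
  simpa using h1

end Multiplicity

/-! ### Right duals, exactness, and simplicity of the unit -/

section Duality

open ExactPairing

variable {C : Type u} [Category.{v} C] [MonoidalCategory C]

theorem coevaluation_whiskerLeft_bijective (X : C) [HasRightDual X] (Z : C) :
    Function.Bijective fun g : Xᘁ ⟶ Z => η_ X Xᘁ ≫ X ◁ g := by
  have h : (fun g : Xᘁ ⟶ Z => η_ X Xᘁ ≫ X ◁ g) =
      ((ρ_ Xᘁ).homCongr (Iso.refl Z)).symm.trans (tensorLeftHomEquiv (𝟙_ C) X Xᘁ Z) := by
    funext g
    rw [Equiv.trans_apply, ← Equiv.symm_apply_eq]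
    simp
  rw [h]
  exact Equiv.bijective _

theorem coevaluation_whiskerRight_bijective (X : C) [HasRightDual X] (Z : C) :
    Function.Bijective fun g : X ⟶ Z => η_ X Xᘁ ≫ g ▷ Xᘁ := by
  have h : (fun g : X ⟶ Z => η_ X Xᘁ ≫ g ▷ Xᘁ) =
      ((λ_ X).homCongr (Iso.refl Z)).symm.trans (tensorRightHomEquiv (𝟙_ C) X Xᘁ Z) := by
    funext g
    rw [Equiv.trans_apply, ← Equiv.symm_apply_eq]
    simp
  rw [h]
  exact Equiv.bijective _

theorem whiskerRight_evaluation_injective (X : C) [HasRightDual X] (Z : C) :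
    Function.Injective fun g : Z ⟶ Xᘁ => g ▷ X ≫ ε_ X Xᘁ := by
  intro g g' h
  have := congrArg (tensorRightHomEquiv Z X Xᘁ (𝟙_ C)) h
  simpa using this

/-- Naturality of `Hom(Xᘁ, Z) ≅ Hom(𝟙, X ⊗ Z)`: precomposing with `fᘁ` becomes postcomposing with `f
▷ Z`. This transfers exactness of the tensor product to duals. -/
theorem coevaluation_whiskerLeft_rightAdjointMate_comp {X Y Z : C} [HasRightDual X]
    [HasRightDual Y] (f : X ⟶ Y) (g : Xᘁ ⟶ Z) :
    η_ Y Yᘁ ≫ Y ◁ (fᘁ ≫ g) = (η_ X Xᘁ ≫ X ◁ g) ≫ f ▷ Z := by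
  rw [whiskerLeft_comp, coevaluation_comp_rightAdjointMate_assoc, Category.assoc,
    whisker_exchange]

theorem exists_eq_rightAdjointMate {X Y : C} [HasRightDual X] [HasRightDual Y] (g : Yᘁ ⟶ Xᘁ) :
    ∃ f : X ⟶ Y, fᘁ = g := by
  obtain ⟨f, hf⟩ := (coevaluation_whiskerRight_bijective X Y).2 (η_ Y Yᘁ ≫ Y ◁ g)
  refine ⟨f, (coevaluation_whiskerLeft_bijective Y _).1 ?_⟩
  dsimp at hf ⊢
  rw [coevaluation_comp_rightAdjointMate, hf]

variable [Abelian C] [MonoidalPreadditive C]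

theorem rightAdjointMate_zero (X Y : C) [HasRightDual X] [HasRightDual Y] :
    (0 : X ⟶ Y)ᘁ = 0 := by
  simp [rightAdjointMate]

theorem coevaluation_ne_zero {X : C} [HasRightDual X] (hX : ¬ IsZero X) : η_ X Xᘁ ≠ 0 := by
  intro h
  refine hX ((IsZero.iff_id_eq_zero X).2 ((coevaluation_whiskerRight_bijective X X).1 ?_))
  simp [h]

theorem exists_unit_hom_ne_zero_iff {X Y : C} [HasRightDual Y] (hX : Simple X) (hY : Simple Y) :
    (∃ f : 𝟙_ C ⟶ X ⊗ Yᘁ, f ≠ 0) ↔ Nonempty (X ≅ Y) := by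
  have hb := coevaluation_whiskerRight_bijective Y X
  constructor
  · rintro ⟨f, hf⟩
    obtain ⟨g, rfl⟩ := hb.2 f
    have hg : g ≠ 0 := by
      rintro rfl
      simp at hf
    have := isIso_of_hom_simple hg
    exact ⟨(asIso g).symm⟩
  · rintro ⟨f⟩
    refine ⟨η_ _ _ ≫ f.inv ▷ _, fun h => ?_⟩
    have h0 : f.inv = 0 := hb.1 (by simpa using h)
    refine id_nonzero X ?_
    rw [← f.hom_inv_id, h0, comp_zero]

variable [RigidCategory C]

instance mono_whiskerRight {X Y : C} (f : X ⟶ Y) [Mono f] (Z : C) : Mono (f ▷ Z) :=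
  (shortExact_tensorRight Z (shortExact_cokernel f)).mono_f

instance epi_whiskerLeft {X Y : C} (f : X ⟶ Y) [Epi f] (Z : C) : Epi (Z ◁ f) :=
  (shortExact_tensorLeft Z (shortExact_kernel f)).epi_g

instance epi_rightAdjointMate {X Y : C} [HasRightDual X] [HasRightDual Y] (f : X ⟶ Y)
    [Mono f] : Epi (fᘁ) :=
  Preadditive.epi_of_cancel_zero _ fun {Z} g hg => by
    apply (coevaluation_whiskerLeft_bijective X Z).1
    have h := coevaluation_whiskerLeft_rightAdjointMate_comp f g
    rw [hg, MonoidalPreadditive.whiskerLeft_zero, comp_zero] at h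
    dsimp
    rw [MonoidalPreadditive.whiskerLeft_zero, comp_zero, ← cancel_mono (f ▷ Z), ← h, zero_comp]

instance mono_rightAdjointMate {X Y : C} [HasRightDual X] [HasRightDual Y] (f : X ⟶ Y)
    [Epi f] : Mono (fᘁ) :=
  Preadditive.mono_of_cancel_zero _ fun {Z} g hg => by
    apply whiskerRight_evaluation_injective Y Z
    dsimp
    rw [MonoidalPreadditive.zero_whiskerRight, zero_comp, ← cancel_epi (Z ◁ f), comp_zero,
      whisker_exchange_assoc, ← rightAdjointMate_comp_evaluation, ← comp_whiskerRight_assoc, hg,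
      MonoidalPreadditive.zero_whiskerRight, zero_comp]

/-- The right dual of a short exact sequence. -/
noncomputable def dualComplex (S : ShortComplex C) : ShortComplex C :=
  ShortComplex.mk (S.gᘁ) (S.fᘁ) (by
    rw [← comp_rightAdjointMate, S.zero, rightAdjointMate_zero])

theorem shortExact_dualComplex {S : ShortComplex C} (hS : S.ShortExact) :
    (dualComplex S).ShortExact := by
  have := hS.mono_f
  have := hS.epi_g
  have : Epi (dualComplex S).g := epi_rightAdjointMate S.f
  -- The cokernel property of the dual is left exactness of `Hom(𝟙, - ⊗ A)` on `S`.
  have hlift : ∀ {A : C} (k : (dualComplex S).X₂ ⟶ A), (dualComplex S).f ≫ k = 0 →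
      ∃ l, (dualComplex S).g ≫ l = k := by
    intro A k hk
    have h := coevaluation_whiskerLeft_rightAdjointMate_comp S.g k
    change S.gᘁ ≫ k = 0 at hk
    rw [hk, MonoidalPreadditive.whiskerLeft_zero, comp_zero] at h
    obtain ⟨m, hm⟩ := shortExact_exists_lift (shortExact_tensorRight A hS) _ h.symm
    obtain ⟨l, rfl⟩ := (coevaluation_whiskerLeft_bijective S.X₁ A).2 m
    refine ⟨l, (coevaluation_whiskerLeft_bijective S.X₂ A).1 ?_⟩
    exact (coevaluation_whiskerLeft_rightAdjointMate_comp S.f l).trans hm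
  exact
    { exact := ShortComplex.exact_of_g_is_cokernel _
        (CokernelCofork.IsColimit.ofπ' _ _ fun k hk => ⟨_, (hlift k hk).choose_spec⟩)
      mono_f := mono_rightAdjointMate S.g }

theorem simple_rightDual {X : C} (hX : Simple X) : Simple (Xᘁ) where
  mono_isIso_iff_nonzero := by
    intro Y f hf
    constructor
    · rintro hf' rfl
      have hz : IsZero (Xᘁ) := (IsZero.iff_id_eq_zero _).2 (by
        rw [← IsIso.inv_hom_id (0 : Y ⟶ Xᘁ), comp_zero])
      refine coevaluation_ne_zero (Simple.not_isZero X) ?_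
      have h := MonoidalPreadditive.whiskerLeft_zero (X := X) (Y := Xᘁ) (Z := Xᘁ)
      rw [← hz.eq_of_src (𝟙 _) 0, whiskerLeft_id] at h
      rw [← Category.comp_id (η_ X Xᘁ), h, comp_zero]
    · intro hf0
      -- With this instance the right dual of `ᘁY` is `Y`, so the subobject `f` is the dual of a
      -- nonzero map out of `X`. That map is mono, which makes `f` epi.
      let : HasRightDual (ᘁY : C) := hasRightDualLeftDual
      obtain ⟨g, rfl⟩ := exists_eq_rightAdjointMate (X := X) (Y := (ᘁY : C)) f
      have hg0 : g ≠ 0 := by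
        rintro rfl
        exact hf0 (rightAdjointMate_zero _ _)
      have := mono_of_nonzero_from_simple hg0
      exact isIso_of_mono_of_epi _

/-- For a simple `i : X ⟶ 𝟙`, the map `X ◁ iᘁ` is a nonzero epi out of a copy of `X`, so `X ⊗ Xᘁ ≅
X`. Coevaluation then gives an epi `𝟙 ⟶ X`; its composite with `i` is a nonzero scalar, so `i` is an
isomorphism. -/
theorem simple_unit {k : Type w} [Field k] [Linear k C] (hfin : FiniteLength (𝟙_ C))
    (hunit : EndUnitEqScalars k C) : Simple (𝟙_ C) := by
  have h1 : ¬ IsZero (𝟙_ C) := fun h => zero_ne_one (hunit.1 (h.eq_of_src _ _) : (0 : k) = 1)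
  obtain ⟨X, i, hX, hi⟩ := hfin.exists_simple_mono h1
  have hη := coevaluation_ne_zero (Simple.not_isZero X)
  have : Simple (X ⊗ (𝟙_ C)ᘁ) :=
    Simple.of_iso (whiskerLeftIso X (rightDualIso HasRightDual.exact exactPairingUnit) ≪≫ ρ_ X)
  have hq : X ◁ (iᘁ) ≠ 0 := fun h => hη (by
    rw [← cancel_mono (𝟙 _), zero_comp]
    have : (𝟙 (X ⊗ Xᘁ)) = 0 := by rw [← cancel_epi (X ◁ (iᘁ)), h]; simp
    rw [this, comp_zero])
  have := isIso_of_epi_of_nonzero hq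
  let e : X ⊗ Xᘁ ≅ X := (asIso (X ◁ (iᘁ))).symm ≪≫
    whiskerLeftIso X (rightDualIso HasRightDual.exact exactPairingUnit) ≪≫ ρ_ X
  have hg : η_ X Xᘁ ≫ e.hom ≠ 0 := fun h => hη (by
    rw [← cancel_mono e.hom, h, zero_comp])
  have := epi_of_nonzero_to_simple hg
  obtain ⟨a, ha⟩ := hunit.2 ((η_ X Xᘁ ≫ e.hom) ≫ i)
  dsimp at ha
  have ha0 : a ≠ 0 := by
    rintro rfl
    rw [zero_smul] at ha
    refine hg ?_
    rw [← cancel_mono i, ← ha, zero_comp]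
  have : Epi i := epi_of_epi_fac (f := a⁻¹ • (η_ X Xᘁ ≫ e.hom)) (h := 𝟙 _) (by
    rw [Linear.smul_comp, ← ha, smul_smul, inv_mul_cancel₀ ha0, one_smul])
  have := isIso_of_mono_of_epi i
  exact Simple.of_iso (asIso i).symm

namespace Gr

variable (C) in
/-- The additive map on the Grothendieck ring induced by right duals. -/
noncomputable def dual : Gr C →+ Gr C :=
  lift (fun X => cls (Xᘁ)) fun S hS => by
    rw [add_comm]
    exact cls_shortExact (shortExact_dualComplex hS)

theorem dual_cls (X : C) : dual C (cls X) = cls (Xᘁ) := lift_cls _ _ X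

theorem dual_mul (x y : Gr C) : dual C (x * y) = dual C y * dual C x := by
  induction x using induction_cls with
  | cls X =>
    induction y using induction_cls with
    | cls Y =>
      rw [cls_mul_cls, dual_cls, dual_cls, dual_cls, cls_mul_cls]
      exact cls_iso (rightDualTensorIso X Y)
    | add y z hy hz => rw [mul_add, map_add, hy, hz, map_add, add_mul]
    | neg y hy => rw [mul_neg, map_neg, hy, map_neg, neg_mul]
  | add x z hx hz => rw [add_mul, map_add, hx, hz, map_add, mul_add]
  | neg x hx => rw [neg_mul, map_neg, hx, map_neg, mul_neg]

end Gr

end Duality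

/-! ### Central idempotents and a positive definite pairing -/

section Algebra

/-- A ring with an anti-multiplicative map `D` and a functional `τ` with `τ 1 = 1` for which
`(x, y) ↦ τ (x * D y)` is orthogonal and positive on a spanning family has no nontrivial central
idempotents. -/
theorem eq_zero_or_one_of_central_idempotent {R I : Type*} [Ring R] (D : R →+ R)
    (hD : ∀ x y, D (x * y) = D y * D x) (τ : R →+ ℤ) (hτ : τ 1 = 1) (b : I → R)
    (hb : Submodule.span ℤ (Set.range b) = ⊤) (hpos : ∀ i, 0 < τ (b i * D (b i)))
    (horth : ∀ i j, i ≠ j → τ (b i * D (b j)) = 0)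
    {e : R} (hc : ∀ x, e * x = x * e) (he : e * e = e) : e = 0 ∨ e = 1 := by
  have expand : ∀ x : R, ∃ c : I →₀ ℤ, x = ∑ i ∈ c.support, c i • b i ∧
      τ (x * D x) = ∑ i ∈ c.support, c i ^ 2 * τ (b i * D (b i)) := by
    intro x
    obtain ⟨c, rfl⟩ := Finsupp.mem_span_range_iff_exists_finsupp.1
      (hb ▸ Submodule.mem_top : x ∈ Submodule.span ℤ (Set.range b))
    refine ⟨c, rfl, ?_⟩
    rw [Finsupp.sum, map_sum D, Finset.sum_mul_sum, map_sum]
    refine Finset.sum_congr rfl fun i hi => ?_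
    rw [map_sum, Finset.sum_eq_single i]
    · simp only [map_zsmul, smul_mul_assoc, mul_smul_comm, smul_eq_mul]
      ring
    · intro j _ hj
      simp only [map_zsmul, smul_mul_assoc, mul_smul_comm, horth i j hj.symm, smul_zero]
    · exact fun h => (h hi).elim
  have nonneg : ∀ x : R, 0 ≤ τ (x * D x) := by
    intro x
    obtain ⟨c, -, h⟩ := expand x
    rw [h]
    exact Finset.sum_nonneg fun i _ => mul_nonneg (sq_nonneg _) (hpos i).le
  have definite : ∀ x : R, τ (x * D x) = 0 → x = 0 := by
    intro x hx
    obtain ⟨c, h, h'⟩ := expand x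
    rw [hx, eq_comm, Finset.sum_eq_zero_iff_of_nonneg
      (fun i _ => mul_nonneg (sq_nonneg _) (hpos i).le)] at h'
    rw [h]
    refine Finset.sum_eq_zero fun i hi => ?_
    have := (mul_eq_zero.1 (h' i hi)).resolve_right (hpos i).ne'
    rw [pow_eq_zero_iff two_ne_zero] at this
    rw [this, zero_smul]
  have key : ∀ f : R, (∀ x, f * x = x * f) → f * f = f → f * D f = f := by
    intro f hc he
    have hDf : D f * D f = D f := by rw [← hD, he]
    -- `D` need not be surjective, so `D f` is not known to be central; this commutation comes from
    -- applying `D` to `f * D f = D f * f`.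
    have hDD : D (D f) * D f = D f * D (D f) := by rw [← hD, hc, hD]
    have h0 : (f - f * D f) * D f = 0 := by rw [sub_mul, mul_assoc, hDf, sub_self]
    refine (sub_eq_zero.1 (definite (f - f * D f) ?_)).symm
    rw [map_sub D, hD f (D f), hDD, mul_sub, ← mul_assoc, h0, zero_mul, sub_zero, map_zero]
  have key₀ := key e hc he
  have key₁ := key (1 - e) (fun x => by rw [sub_mul, mul_sub, hc, one_mul, mul_one])
    (by simp [sub_mul, mul_sub, he])
  have h₀ := nonneg e
  have h₁ := nonneg (1 - e)
  rw [key₀] at h₀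
  rw [key₁, map_sub, hτ] at h₁
  obtain h | h : τ e = 0 ∨ τ e = 1 := by lia
  · exact Or.inl (definite e (by rw [key₀, h]))
  · exact Or.inr (sub_eq_zero.1 (definite (1 - e) (by rw [key₁, map_sub, hτ, h, sub_self]))).symm

end Algebra

end TensorCat

/-! ### Assembly -/

theorem corollary2p2 {k : Type w} [Field k] {C : Type u} [Category.{v} C] [Abelian C] [Linear k C]
    [MonoidalCategory C] [MonoidalPreadditive C] [MonoidalLinear k C] [RigidCategory C]
    (hfin : TensorCat.LocallyFinite k C) (hunit : TensorCat.EndUnitEqScalars k C)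
    (hChev : TensorCat.ChevalleyProperty C) :
    TensorCat.VirtuallyIndecomposable C := by
  classical
  intro e hc he
  have h1 := TensorCat.simple_unit (hfin.finiteLength _) hunit
  obtain ⟨τ, hτ⟩ := TensorCat.Gr.exists_multiplicity hfin.finiteLength (𝟙_ C)
  -- One representative per isomorphism class, so that distinct indices give non-isomorphic simples,
  -- as orthogonality requires.
  let I := {q : Quotient (isIsomorphicSetoid C) // Simple q.out}
  have hout : ∀ X : C, Nonempty (X ≅ (Quotient.mk (isIsomorphicSetoid C) X).out) := fun X => by
    obtain ⟨f⟩ := @Quotient.mk_out _ (isIsomorphicSetoid C) X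
    exact ⟨f.symm⟩
  have hne : ∀ i j : I, Nonempty (i.1.out ≅ j.1.out) → i = j := fun i j h => by
    refine Subtype.ext ?_
    rw [← i.1.out_eq, ← j.1.out_eq]
    exact Quotient.sound h
  have hmul : ∀ i j : I, TensorCat.Gr.cls i.1.out * TensorCat.Gr.dual C (TensorCat.Gr.cls j.1.out)
      = TensorCat.Gr.cls (i.1.out ⊗ (j.1.outᘁ : C)) := fun i j => by
    rw [TensorCat.Gr.dual_cls, TensorCat.Gr.cls_mul_cls]
  refine TensorCat.eq_zero_or_one_of_central_idempotent (TensorCat.Gr.dual C)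
    TensorCat.Gr.dual_mul τ ?_ (fun i : I => TensorCat.Gr.cls i.1.out) ?_ ?_ ?_
    (fun x => (Subring.mem_center_iff.1 hc x).symm) he
  · rw [TensorCat.Gr.one_eq_cls, hτ _ h1, if_pos ⟨Iso.refl _⟩]
  · refine TensorCat.Gr.span_simple_eq_top hfin.finiteLength _ fun X hX => ?_
    obtain ⟨f⟩ := hout X
    exact ⟨⟨_, Simple.of_iso f.symm⟩, ⟨f⟩⟩
  · intro i
    obtain ⟨f, hf⟩ := (TensorCat.exists_unit_hom_ne_zero_iff i.2 i.2).2 ⟨Iso.refl _⟩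
    rw [hmul]
    -- The only use of the Chevalley property; positivity above holds without it.
    exact TensorCat.Gr.multiplicity_pos hfin.finiteLength h1 hτ hf
  · intro i j hij
    rw [hmul]
    refine TensorCat.Gr.multiplicity_eq_zero hτ (hChev _ _ (.of_simple i.2) (.of_simple
      (TensorCat.simple_rightDual j.2))) fun f => ?_
    by_contra hf
    exact hij (hne _ _ ((TensorCat.exists_unit_hom_ne_zero_iff i.2 j.2).1 ⟨f, hf⟩))
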